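/- Let $n\ge 0$, $q\ge 0$ be integers and let $\mathcal A=\mathbb R[\sigma_1^{\pm1},\dots,\sigma_n^{\pm1}]$ be the real Laurent polynomial ring in $n$ variables; for $0\le d'\le n$ let $\mathcal A_{d'}=\mathbb R[\sigma_1^{\pm1},\dots,\sigma_{d'}^{\pm1}]\subseteq\mathcal A$ be the subring in the first $d'$ variables. For a unimodular matrix $T\in\mathbb Z^{n\times n}$ (i.e. $\det T=\pm1$) let $\varphi_T$ be the $\mathbb R$-algebra automorphism of $\mathcal A$ with $\varphi_T(\sigma^\nu)=\sigma^{T\nu}$ for all $\nu\in\mathbb Z^n$, and let $\widehat\varphi_T:\mathcal A^q\to\mathcal A^q$ apply $\varphi_T$ to each entry; it maps submodules onto submodules. Let $\mathcal R\subseteq\mathcal A^q$ be a submodule, and let $d$ be the Krull dimension of the ring $\mathcal A/\mathrm{ann}_{\mathcal A}(\mathcal A^q/\mathcal R)$ (with the convention that the zero ring has Krull dimension $-\infty$). Then: 1. For every integer $d'$ with $0\le d'\le n$, there exists a unimodular $T\in\mathbb Z^{n\times n}$ such that $\mathcal A^q/\widehat\varphi_T(\mathcal R)$ is finitely generated as a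 module over $\mathcal A_{d'}$ if and only if $d'\ge d$. 2. The matrix can be chosen independently of $d'$: there is a unimodular $T\in\mathbb Z^{n\times n}$ such that, for every integer $0\le d'\le n$, the module $\mathcal A^q/\widehat\varphi_T(\mathcal R)$ is finitely generated over $\mathcal A_{d'}$ if and only if $d'\ge d$. 3. Hence no coordinate change yields a state space of dimension below $d$. Precisely, suppose that $T\in\mathbb Z^{n\times n}$ is unimodular, $0\le d'\le n$, that $g_1,\dots,g_\gamma$ generate $\mathcal A^q/\widehat\varphi_T(\mathcal R)$ as an $\mathcal A_{d'}$-module, and that $X\in\mathcal A_{d'}^{\delta\times\gamma}$ is a matrix whose rows generate the kernel of the $\mathcal A_{d'}$-linear map $\mathcal A_{d'}^\gamma\to\mathcal A^q/\widehat\varphi_T(\mathcal R)$, $e_j\mapsto g_j$, so that $\mathcal X=\{x:\mathbb Z^{d'}\to\mathbb R^\gamma \mid Xx=0\}$ (with $\sigma^\mu$ acting by $(\sigma^\mu w)(\nu)=w(\nu+\mu)$) is a state space, which is a $d'$-dimensional behavior. Then $d'\ge d$. -/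

import Mathlib

noncomputable section

/-- The Laurent polynomial ring `𝒜 = ℝ[σ₁^{±1}, …, σₙ^{±1}]`: the group algebra of `ℤⁿ` over `ℝ`,
in which `single ν 1` is the monomial `σ^ν`. -/
abbrev LaurentRing (n : ℕ) : Type := AddMonoidAlgebra ℝ (Fin n → ℤ)

/-- The monomial `σ^ν = σ₁^{ν₁} ⋯ σₙ^{νₙ}`. -/
def monom {n : ℕ} (ν : Fin n → ℤ) : LaurentRing n := AddMonoidAlgebra.single ν 1

/-- The Laurent polynomial ring `ℝ[σ₁^{±1}, …, σ_d^{±1}]` in the first `d` indeterminates,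
as an `ℝ`-subalgebra of `ℝ[σ₁^{±1}, …, σₙ^{±1}]`. -/
def laurentSubring (n d : ℕ) : Subalgebra ℝ (LaurentRing n) :=
  Algebra.adjoin ℝ {f | ∃ i : Fin n, (i : ℕ) < d ∧
    (f = monom (Pi.single i 1) ∨ f = monom (Pi.single i (-1)))}

/-- The coordinate change `ν ↦ T ν` of `ℤⁿ` given by a unimodular integer matrix `T`. -/
def coordChange {n : ℕ} (T : Matrix.GeneralLinearGroup (Fin n) ℤ) : (Fin n → ℤ) ≃+ (Fin n → ℤ) where
  toFun ν := T.val.mulVec ν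
  invFun ν := (T⁻¹).val.mulVec ν
  left_inv ν := by
    beta_reduce
    rw [Matrix.mulVec_mulVec, ← Matrix.GeneralLinearGroup.coe_mul]; simp
  right_inv ν := by
    beta_reduce
    rw [Matrix.mulVec_mulVec, ← Matrix.GeneralLinearGroup.coe_mul]; simp
  map_add' ν μ := Matrix.mulVec_add _ _ _

/-- The `ℝ`-algebra automorphism `φ_T` of `𝒜` with `σ^ν ↦ σ^{Tν}`. -/
def phi {n : ℕ} (T : Matrix.GeneralLinearGroup (Fin n) ℤ) : LaurentRing n ≃ₐ[ℝ] LaurentRing n :=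
  AddMonoidAlgebra.domCongr ℝ ℝ (coordChange T)

theorem phi_monom {n : ℕ} (T : Matrix.GeneralLinearGroup (Fin n) ℤ) (ν : Fin n → ℤ) :
    phi T (monom ν) = monom (T.val.mulVec ν) := by
  simp [phi, monom, coordChange]

/-- The map `φ̂_T : 𝒜^q → 𝒜^q` applying `φ_T` to each entry. -/
def phiHat {n q : ℕ} (T : Matrix.GeneralLinearGroup (Fin n) ℤ) (r : Fin q → LaurentRing n) :
    Fin q → LaurentRing n :=
  fun i => phi T (r i)

/-- The image `φ̂_T(R)` of a submodule `R ⊆ 𝒜^q`, which is again a submodule. -/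
def phiHatImage {n q : ℕ} (T : Matrix.GeneralLinearGroup (Fin n) ℤ)
    (R : Submodule (LaurentRing n) (Fin q → LaurentRing n)) :
    Submodule (LaurentRing n) (Fin q → LaurentRing n) where
  carrier := phiHat T '' R
  add_mem' := by
    rintro _ _ ⟨a, ha, rfl⟩ ⟨b, hb, rfl⟩
    exact ⟨a + b, R.add_mem ha hb, by funext i; simp [phiHat]⟩
  zero_mem' := ⟨0, R.zero_mem, by funext i; simp [phiHat]⟩
  smul_mem' := by
    rintro c _ ⟨a, ha, rfl⟩
    exact ⟨(phi T).symm c • a, R.smul_mem _ ha, by funext i; simp [phiHat]⟩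

/-- The quotient module `𝒜^q / R`. -/
abbrev QuotientModule {n q : ℕ} (R : Submodule (LaurentRing n) (Fin q → LaurentRing n)) : Type :=
  (Fin q → LaurentRing n) ⧸ R

/-- The action of `f ∈ ℝ[σ₁^{±1}, …, σ_d^{±1}]` on a `d`-dimensional trajectory `w : ℤ^d → ℝ` by
shifts: `σ^μ` sends `w` to `ν ↦ w (ν + μ)`. Exponents of such an `f` vanish beyond the
first `d` entries, so only those entries are used. -/
def shiftAct {n d : ℕ} (h : d ≤ n) (f : laurentSubring n d) (w : (Fin d → ℤ) → ℝ) :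
    (Fin d → ℤ) → ℝ :=
  fun ν => (f : LaurentRing n).coeff.sum fun μ a => a * w (fun i => ν i + μ (Fin.castLE h i))

/-- The `d`-dimensional behavior `{x : ℤ^d → ℝ^γ | X x = 0}` with kernel representation matrix `X`
over `ℝ[σ₁^{±1}, …, σ_d^{±1}]`. -/
def kernelBehavior {n d γ δ : ℕ} (h : d ≤ n) (X : Matrix (Fin δ) (Fin γ) (laurentSubring n d)) :
    Set (Fin γ → (Fin d → ℤ) → ℝ) :=
  {x | ∀ k, ∑ j, shiftAct h (X k j) (x j) = 0}

/-- `𝒳` is a (`d`-dimensional) state space of the system with equation module `R`: there are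
generators `g₁, …, g_γ` of `𝒜^q / R` as a module over `ℝ[σ₁^{±1}, …, σ_d^{±1}]` and a
matrix of relations `X` of these generators (its rows generate the kernel of `e_j ↦ g_j`) such
that `𝒳 = {x | X x = 0}`. -/
def IsStateSpace {n q d γ : ℕ} (h : d ≤ n)
    (R : Submodule (LaurentRing n) (Fin q → LaurentRing n))
    (𝒳 : Set (Fin γ → (Fin d → ℤ) → ℝ)) : Prop :=
  ∃ g : Fin γ → QuotientModule R,
    Submodule.span (laurentSubring n d) (Set.range g) = ⊤ ∧
    ∃ (δ : ℕ) (X : Matrix (Fin δ) (Fin γ) (laurentSubring n d)),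
      Submodule.span (laurentSubring n d) (Set.range fun k => X k) =
        LinearMap.ker (Fintype.linearCombination (laurentSubring n d) g) ∧
      𝒳 = kernelBehavior h X

end

/-! This is Noether normalization with monomial coordinate changes. A finite `𝒜`-module `M` is
finite over `𝒜_e` exactly when `𝒜/ann M` is integral over `𝒜_e`, and integrality forces `dim ≤ dim
𝒜_e = e`; this is the lower bound on `d'`. For existence, descend from `e = n`. If `𝒜/J` is integral
over `𝒜_{e+1}` but has dimension below `e + 1`, then `𝒜_{e+1} → 𝒜/J` is not injective, so `J`
contains a nonzero `f ∈ 𝒜_{e+1}`. A shear gives the terms of `f` distinct degrees in the last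
variable; its top and bottom coefficients are then units, so that variable and its inverse are both
integral over `𝒜_e` (`exists_isIntegral_laurentToQuotient_of_ne_zero`). Integrality persists as `e`
grows, so the `T` for the least admissible `e` serves every `d'`. -/

/-! ### Krull dimension of Laurent polynomial rings -/

theorem ringKrullDim_le_of_isLocalization {R S : Type*} [CommRing R] [CommRing S] [Algebra R S]
    (M : Submonoid R) [IsLocalization M S] : ringKrullDim S ≤ ringKrullDim R :=
  Order.krullDim_le_of_strictMono (PrimeSpectrum.comap (algebraMap R S)) fun _ _ h =>
    (IsLocalization.orderEmbedding M S).strictMono h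

theorem RingHom.IsIntegral.ringKrullDim_le {R S : Type*} [CommRing R] [CommRing S] {f : R →+* S}
    (hf : f.IsIntegral) : ringKrullDim S ≤ ringKrullDim R := by
  let := f.toAlgebra
  have : Algebra.IsIntegral R S := ⟨hf⟩
  exact Order.krullDim_le_of_strictMono (PrimeSpectrum.comap (algebraMap R S)) fun _ _ h =>
    Ideal.IsIntegral.comap_lt_comap h

/-- Lying over lifts the bottom prime of a chain, and going up lifts the rest. -/
theorem RingHom.IsIntegral.ringKrullDim_ge {R S : Type*} [CommRing R] [CommRing S] {f : R →+* S}
    (hf : f.IsIntegral) (hinj : Function.Injective f) : ringKrullDim R ≤ ringKrullDim S := by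
  let := f.toAlgebra
  have : Algebra.IsIntegral R S := ⟨hf⟩
  refine iSup_le fun l => ?_
  obtain ⟨Q, hQ, hQl⟩ := Ideal.exists_ideal_over_prime_of_isIntegral (S := S)
    (RelSeries.head l).asIdeal ⊥ (by
      rw [← RingHom.ker_eq_comap_bot,
        (RingHom.injective_iff_ker_eq_bot (algebraMap R S)).1 hinj]
      exact bot_le)
  have : Q.LiesOver (RelSeries.head l).asIdeal := ⟨hQl.2.symm⟩
  have := hQl.1
  obtain ⟨L, hL, -⟩ := Ideal.exists_ltSeries_of_hasGoingUp l Q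
  exact hL ▸ Order.LTSeries.length_le_krullDim L

-- Upper bound: localization of `R[X]`. Lower bound: `T - 1` is a nonzerodivisor killed by the
-- surjection `T ↦ 1` onto `R`.
open LaurentPolynomial in
theorem LaurentPolynomial.ringKrullDim_eq (R : Type*) [CommRing R] [IsDomain R]
    [IsNoetherianRing R] : ringKrullDim R[T;T⁻¹] = ringKrullDim R + 1 := by
  apply le_antisymm
  · rw [← Polynomial.ringKrullDim_of_isNoetherianRing]
    exact ringKrullDim_le_of_isLocalization (Submonoid.powers (Polynomial.X : Polynomial R))
  · refine ringKrullDim_succ_le_of_surjective (LaurentPolynomial.eval₂ (RingHom.id R) 1)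
      (fun r => ⟨C r, by simp⟩) (r := T 1 - 1) ?_ (by simp)
    refine mem_nonZeroDivisors_of_ne_zero fun h => ?_
    have h1 := congrArg (fun f : R[T;T⁻¹] => f.coeff 1) (sub_eq_zero.1 h)
    rw [← T_zero] at h1
    simp [T, -single_eq_C_mul_T] at h1

/-- The claims share one induction because the dimension formula needs a Noetherian base. -/
theorem LaurentRing.ringKrullDim_eq_and_isNoetherianRing (n : ℕ) :
    ringKrullDim (LaurentRing n) = n ∧ IsNoetherianRing (LaurentRing n) := by
  induction n with
  | zero =>
    let e : LaurentRing 0 ≃+* ℝ := AddMonoidAlgebra.uniqueRingEquiv (Fin 0 → ℤ)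
    exact ⟨(ringKrullDim_eq_of_ringEquiv e).trans (ringKrullDim_eq_zero_of_field ℝ),
      isNoetherianRing_of_ringEquiv _ e.symm⟩
  | succ n ih =>
    have := ih.2
    let c : (ℤ × (Fin n → ℤ)) ≃+ (Fin (n + 1) → ℤ) :=
      { Fin.consEquiv fun _ : Fin (n + 1) => ℤ with
        map_add' := fun x y => by
          ext i
          refine Fin.cases ?_ (fun _ => ?_) i <;> simp [Fin.consEquiv] }
    let e : LaurentRing (n + 1) ≃+* LaurentPolynomial (LaurentRing n) :=
      (AddMonoidAlgebra.domCongr ℝ ℝ c.symm).toRingEquiv.trans AddMonoidAlgebra.curryRingEquiv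
    constructor
    · rw [ringKrullDim_eq_of_ringEquiv e, LaurentPolynomial.ringKrullDim_eq, ih.1]; simp
    · have : IsNoetherianRing (LaurentPolynomial (LaurentRing n)) :=
        IsLocalization.isNoetherianRing
          (Submonoid.powers (Polynomial.X : Polynomial (LaurentRing n))) _ inferInstance
      exact isNoetherianRing_of_ringEquiv _ e.symm

/-! ### Monomials and the subrings in the first variables -/

theorem monom_zero {n : ℕ} : (monom 0 : LaurentRing n) = 1 := rfl

theorem monom_add {n : ℕ} (ν μ : Fin n → ℤ) : monom (ν + μ) = monom ν * monom μ := by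
  simp [monom, AddMonoidAlgebra.single_mul_single]

theorem monom_sum {n : ℕ} {ι : Type*} (s : Finset ι) (ν : ι → Fin n → ℤ) :
    monom (∑ i ∈ s, ν i) = ∏ i ∈ s, monom (ν i) := by
  classical
  induction s using Finset.induction_on with
  | empty => simp [monom_zero]
  | insert i s hi ih => rw [Finset.sum_insert hi, Finset.prod_insert hi, monom_add, ih]

theorem monom_nsmul {n : ℕ} (k : ℕ) (ν : Fin n → ℤ) : monom (k • ν) = monom ν ^ k := by
  induction k with
  | zero => simp [monom_zero]
  | succ k ih => rw [succ_nsmul, monom_add, ih, pow_succ]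

theorem sum_smul_monom {n : ℕ} (f : LaurentRing n) :
    ∑ ν ∈ f.coeff.support, f.coeff ν • monom ν = f := by
  conv_rhs => rw [← AddMonoidAlgebra.sum_coeff_single f]
  exact Finset.sum_congr rfl fun ν _ => by simp [monom]

theorem monom_mem_laurentSubring {n e : ℕ} {ν : Fin n → ℤ} (hν : ∀ i : Fin n, e ≤ i → ν i = 0) :
    monom ν ∈ laurentSubring n e := by
  rw [← Finset.univ_sum_single ν, monom_sum]
  refine Subalgebra.prod_mem _ fun i _ => ?_
  by_cases hi : e ≤ i
  · rw [hν i hi, Pi.single_zero, monom_zero]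
    exact one_mem _
  · obtain ⟨k, hk | hk⟩ := Int.eq_nat_or_neg (ν i)
    · have : (Pi.single i (ν i) : Fin n → ℤ) = k • Pi.single i 1 := by
        rw [← Pi.single_smul, hk]; simp
      rw [this, monom_nsmul]
      have hg : monom (Pi.single i 1) ∈ laurentSubring n e :=
        Algebra.subset_adjoin ⟨i, not_le.1 hi, Or.inl rfl⟩
      exact pow_mem hg k
    · have : (Pi.single i (ν i) : Fin n → ℤ) = k • Pi.single i (-1) := by
        rw [← Pi.single_smul, hk]; simp
      rw [this, monom_nsmul]
      have hg : monom (Pi.single i (-1)) ∈ laurentSubring n e :=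
        Algebra.subset_adjoin ⟨i, not_le.1 hi, Or.inr rfl⟩
      exact pow_mem hg k

theorem mem_laurentSubring_of_support {n e : ℕ} {f : LaurentRing n}
    (hf : ∀ ν ∈ f.coeff.support, ∀ i : Fin n, e ≤ i → ν i = 0) : f ∈ laurentSubring n e := by
  rw [← sum_smul_monom f]
  exact Subalgebra.sum_mem _ fun ν hν =>
    Subalgebra.smul_mem _ (monom_mem_laurentSubring (hf ν hν)) _

/-- Extension of an exponent vector by zero. -/
def extendExponent (e n : ℕ) : (Fin e → ℤ) →+ (Fin n → ℤ) where
  toFun ν i := if h : (i : ℕ) < e then ν ⟨i, h⟩ else 0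
  map_zero' := by ext i; simp
  map_add' ν μ := by
    ext i
    by_cases h : (i : ℕ) < e <;> simp [h]

theorem extendExponent_injective {e n : ℕ} (h : e ≤ n) :
    Function.Injective (extendExponent e n) := fun ν μ hνμ => by
  ext i
  simpa [extendExponent] using congrFun hνμ (Fin.castLE h i)

theorem extendExponent_single {e n : ℕ} (h : e ≤ n) (i : Fin e) (k : ℤ) :
    extendExponent e n (Pi.single i k) = Pi.single (Fin.castLE h i) k := by
  ext j
  by_cases hj : (j : ℕ) < e <;> simp [extendExponent, Pi.single_apply, Fin.ext_iff, hj]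
  intro hji
  omega

theorem range_mapDomainAlgHom_extendExponent {e n : ℕ} (h : e ≤ n) :
    (AddMonoidAlgebra.mapDomainAlgHom ℝ ℝ (extendExponent e n)).range = laurentSubring n e := by
  apply le_antisymm
  · rintro _ ⟨f, rfl⟩
    change AddMonoidAlgebra.mapDomainAlgHom ℝ ℝ (extendExponent e n) f ∈ _
    rw [← sum_smul_monom f]
    simp only [map_sum, map_smul]
    refine Subalgebra.sum_mem _ fun ν _ => Subalgebra.smul_mem _ ?_ _
    simp only [monom, AddMonoidAlgebra.mapDomainAlgHom_apply, AddMonoidAlgebra.mapDomain_single]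
    exact monom_mem_laurentSubring fun i hi => by simp [extendExponent, hi]
  · refine Algebra.adjoin_le ?_
    rintro f ⟨i, hi, rfl | rfl⟩
    · exact ⟨monom (Pi.single ⟨i, hi⟩ 1), by simp [monom, extendExponent_single h]⟩
    · exact ⟨monom (Pi.single ⟨i, hi⟩ (-1)), by simp [monom, extendExponent_single h]⟩

theorem eq_zero_of_mem_support {n e : ℕ} (h : e ≤ n) {f : LaurentRing n}
    (hf : f ∈ laurentSubring n e) {ν : Fin n → ℤ} (hν : ν ∈ f.coeff.support) {i : Fin n}
    (hi : e ≤ i) : ν i = 0 := by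
  classical
  rw [← range_mapDomainAlgHom_extendExponent h] at hf
  obtain ⟨g, rfl⟩ := hf
  obtain ⟨μ, -, rfl⟩ := Finset.mem_image.1 (Finsupp.mapDomain_support hν)
  simp [extendExponent, hi]

theorem ringKrullDim_laurentSubring {n e : ℕ} (h : e ≤ n) :
    ringKrullDim (laurentSubring n e) = e := by
  rw [← range_mapDomainAlgHom_extendExponent h,
    ← (LaurentRing.ringKrullDim_eq_and_isNoetherianRing e).1]
  exact (ringKrullDim_eq_of_ringEquiv (AlgEquiv.ofInjective
    (AddMonoidAlgebra.mapDomainAlgHom ℝ ℝ (extendExponent e n))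
    (AddMonoidAlgebra.mapDomain_injective (extendExponent_injective h))).toRingEquiv).symm

theorem laurentSubring_self (n : ℕ) : laurentSubring n n = ⊤ :=
  top_unique fun _ _ => mem_laurentSubring_of_support fun _ _ i hi => absurd i.2 (not_lt.2 hi)

theorem laurentSubring_mono {n e e' : ℕ} (h : e ≤ e') : laurentSubring n e ≤ laurentSubring n e' :=
  Algebra.adjoin_mono fun _ ⟨i, hi, hf⟩ => ⟨i, hi.trans_le h, hf⟩

/-! ### Finiteness of a module versus integrality modulo its annihilator -/

/-- The structure map `ℝ[σ₁^{±1}, …, σ_e^{±1}] → 𝒜 / J`. -/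
noncomputable abbrev laurentToQuotient {n : ℕ} (e : ℕ) (J : Ideal (LaurentRing n)) :
    laurentSubring n e →+* LaurentRing n ⧸ J :=
  (Ideal.Quotient.mk J).comp (laurentSubring n e).val.toRingHom

/-- Cayley–Hamilton for multiplication by `a` on `M`: the resulting monic expression in `a` kills
`M`, hence vanishes modulo the annihilator. -/
theorem isIntegral_laurentToQuotient_of_finite {n e : ℕ} (M : Type*) [AddCommGroup M]
    [Module (LaurentRing n) M] [Module.Finite (laurentSubring n e) M] :
    (laurentToQuotient e (Module.annihilator (LaurentRing n) M)).IsIntegral := by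
  intro x
  obtain ⟨a, rfl⟩ := Ideal.Quotient.mk_surjective x
  obtain ⟨p, hp, hpa⟩ := LinearMap.exists_monic_and_aeval_eq_zero (laurentSubring n e)
    (Algebra.lsmul (laurentSubring n e) (laurentSubring n e) M a)
  refine ⟨p, hp, ?_⟩
  rw [← Polynomial.hom_eval₂, Ideal.Quotient.eq_zero_iff_mem, Module.mem_annihilator]
  intro m
  rw [Polynomial.aeval_algHom_apply] at hpa
  exact LinearMap.congr_fun hpa m

/-- An integral algebra of finite type is a finite module, and `M` is finite over `𝒜/ann M`. -/
theorem finite_of_isIntegral_laurentToQuotient {n e : ℕ} (M : Type*) [AddCommGroup M]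
    [Module (LaurentRing n) M] [Module.Finite (LaurentRing n) M]
    (h : (laurentToQuotient e (Module.annihilator (LaurentRing n) M)).IsIntegral) :
    Module.Finite (laurentSubring n e) M := by
  let A := LaurentRing n ⧸ Module.annihilator (LaurentRing n) M
  have : Algebra.IsIntegral (laurentSubring n e) A := ⟨h⟩
  have hft : Algebra.FiniteType (laurentSubring n e) A := by
    have : Algebra.FiniteType ℝ (LaurentRing n) := inferInstance
    have : Algebra.FiniteType ℝ A := inferInstance
    exact Algebra.FiniteType.of_restrictScalars_finiteType ℝ (laurentSubring n e) A
  have : Module.Finite (laurentSubring n e) A := Algebra.IsIntegral.finite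
  let : Module A M := Module.quotientAnnihilator
  have : IsScalarTower (LaurentRing n) A M := 
    (Module.isTorsionBySet_annihilator (LaurentRing n) M).isScalarTower
  have : IsScalarTower (laurentSubring n e) A M := ⟨fun r a m => by
    obtain ⟨a, rfl⟩ := Ideal.Quotient.mk_surjective a
    exact smul_assoc (r : LaurentRing n) (Ideal.Quotient.mk _ a : A) m⟩
  have : Module.Finite A M := Module.Finite.of_restrictScalars_finite (LaurentRing n) A M
  exact Module.Finite.trans A M

theorem ringKrullDim_le_of_isIntegral {n e : ℕ} (he : e ≤ n) {J : Ideal (LaurentRing n)}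
    (h : (laurentToQuotient e J).IsIntegral) : ringKrullDim (LaurentRing n ⧸ J) ≤ e :=
  h.ringKrullDim_le.trans_eq (ringKrullDim_laurentSubring he)

theorem exists_ne_zero_mem_of_ringKrullDim_lt {n e : ℕ} (he : e ≤ n) {J : Ideal (LaurentRing n)}
    (h : (laurentToQuotient e J).IsIntegral) (hd : ringKrullDim (LaurentRing n ⧸ J) < e) :
    ∃ f ∈ J, f ∈ laurentSubring n e ∧ f ≠ 0 := by
  by_contra! H
  refine hd.not_ge ((ringKrullDim_laurentSubring he).symm.trans_le (h.ringKrullDim_ge ?_))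
  refine (injective_iff_map_eq_zero _).2 fun f hf => Subtype.ext ?_
  exact H f (Ideal.Quotient.eq_zero_iff_mem.1 hf) f.2

theorem laurentToQuotient_isIntegral_mono {n e e' : ℕ} (h : e ≤ e') {J : Ideal (LaurentRing n)}
    (hJ : (laurentToQuotient e J).IsIntegral) : (laurentToQuotient e' J).IsIntegral :=
  RingHom.IsIntegral.tower_top (Subalgebra.inclusion (laurentSubring_mono h)).toRingHom
    (laurentToQuotient e' J) hJ

theorem laurentToQuotient_self_isIntegral {n : ℕ} (J : Ideal (LaurentRing n)) :
    (laurentToQuotient n J).IsIntegral := by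
  refine RingHom.isIntegral_of_surjective _ fun x => ?_
  obtain ⟨a, rfl⟩ := Ideal.Quotient.mk_surjective x
  exact ⟨⟨a, laurentSubring_self n ▸ Algebra.mem_top⟩, rfl⟩

/-! ### Coordinate changes and annihilators -/

theorem phi_mul {n : ℕ} (S T : Matrix.GeneralLinearGroup (Fin n) ℤ) (f : LaurentRing n) :
    phi (S * T) f = phi S (phi T f) := by
  rw [← sum_smul_monom f]
  simp only [map_sum, map_smul, phi_monom, Matrix.mulVec_mulVec]
  rfl

theorem phi_mem_annihilator_iff {n q : ℕ} (T : Matrix.GeneralLinearGroup (Fin n) ℤ)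
    (R : Submodule (LaurentRing n) (Fin q → LaurentRing n)) (f : LaurentRing n) :
    phi T f ∈ Module.annihilator (LaurentRing n) (QuotientModule (phiHatImage T R)) ↔
      f ∈ Module.annihilator (LaurentRing n) (QuotientModule R) := by
  simp only [Submodule.annihilator_quotient, Submodule.mem_colon]
  constructor
  · intro h v _
    obtain ⟨w, hw, hwv⟩ := h (phiHat T v) trivial
    have : w = f • v := funext fun i => (phi T).injective <| by
      simpa [phiHat] using congrFun hwv i
    exact this ▸ hw
  · intro h v _
    refine ⟨_, h (fun i => (phi T).symm (v i)) trivial, ?_⟩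
    ext1 i
    simp [phiHat]

theorem annihilator_phiHatImage {n q : ℕ} (T : Matrix.GeneralLinearGroup (Fin n) ℤ)
    (R : Submodule (LaurentRing n) (Fin q → LaurentRing n)) :
    Module.annihilator (LaurentRing n) (QuotientModule (phiHatImage T R)) =
      (Module.annihilator (LaurentRing n) (QuotientModule R)).map (phi T : LaurentRing n →+* _) := by
  ext f
  obtain ⟨f, rfl⟩ := (phi T).surjective f
  rw [phi_mem_annihilator_iff]
  refine ⟨fun h => Ideal.mem_map_of_mem _ h, fun h => ?_⟩
  obtain ⟨g, hg, hgf⟩ := (Ideal.mem_map_of_equiv (phi T) _).1 h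
  exact (phi T).injective hgf ▸ hg

theorem ringKrullDim_quotient_map_phi {n : ℕ} (T : Matrix.GeneralLinearGroup (Fin n) ℤ)
    (I : Ideal (LaurentRing n)) :
    ringKrullDim (LaurentRing n ⧸ I.map (phi T : LaurentRing n →+* LaurentRing n)) =
      ringKrullDim (LaurentRing n ⧸ I) :=
  (ringKrullDim_eq_of_ringEquiv (Ideal.quotientEquiv I _ (phi T).toRingEquiv rfl)).symm

/-! ### Noether normalization by shears -/

/-- Multiplying the relation by `u ^ (N + 1)` clears the powers of `v = u⁻¹`; since every `k j ≥ 1`,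
the result is monic in `u`. -/
theorem RingHom.isIntegralElem_of_sum_inv_pow_eq_one {R S ι : Type*} [CommRing R] [CommRing S]
    (f : R →+* S) {u v : S} (huv : u * v = 1) (s : Finset ι) (r : ι → R) (k : ι → ℕ)
    (hk : ∀ j ∈ s, 1 ≤ k j) (h : ∑ j ∈ s, f (r j) * v ^ k j = 1) : f.IsIntegralElem u := by
  obtain ⟨N, hN⟩ : ∃ N, ∀ j ∈ s, k j ≤ N := ⟨s.sup k, fun j hj => Finset.le_sup hj⟩
  let p : Polynomial R := ∑ j ∈ s, Polynomial.C (r j) * Polynomial.X ^ (N + 1 - k j)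
  have hp : p.degree ≤ N := by
    refine (Polynomial.degree_sum_le s _).trans (Finset.sup_le fun j hj => ?_)
    refine (Polynomial.degree_C_mul_X_pow_le _ _).trans ?_
    have := hk j hj
    exact_mod_cast (by omega : N + 1 - k j ≤ N)
  refine ⟨Polynomial.X ^ (N + 1) - p, Polynomial.monic_X_pow_sub
    (hp.trans_lt (by exact_mod_cast N.lt_succ_self)), ?_⟩
  · rw [Polynomial.eval₂_sub, Polynomial.eval₂_pow, Polynomial.eval₂_X, sub_eq_zero,
      Polynomial.eval₂_finsetSum]
    rw [← mul_one (u ^ (N + 1)), ← h, Finset.mul_sum]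
    refine Finset.sum_congr rfl fun j hj => ?_
    have hle : k j ≤ N + 1 := (hN j hj).trans N.le_succ
    rw [Polynomial.eval₂_mul, Polynomial.eval₂_C, Polynomial.eval₂_pow, Polynomial.eval₂_X]
    calc u ^ (N + 1) * (f (r j) * v ^ k j)
        = u ^ (N + 1 - k j) * u ^ k j * (f (r j) * v ^ k j) := by
          rw [← pow_add, Nat.sub_add_cancel hle]
      _ = f (r j) * u ^ (N + 1 - k j) * (u * v) ^ k j := by rw [mul_pow]; ring
      _ = f (r j) * u ^ (N + 1 - k j) := by rw [huv, one_pow, mul_one]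

/-- Dividing `g` by its unique extremal term, a unit, writes `1` modulo `J` as a combination of
positive powers of `σ_m^{-ε}` over `𝒜_m`. The sign `ε = ±1` treats the variable and its inverse
together. -/
theorem isIntegralElem_monom_of_unique_max {n : ℕ} {J : Ideal (LaurentRing n)}
    {g : LaurentRing n} (hg : g ∈ J) (m : Fin n) {ε : ℤ} (hε : ε * ε = 1)
    (hsupp : ∀ ν ∈ g.coeff.support, ∀ i, m < i → ν i = 0) {ν₀ : Fin n → ℤ}
    (hν₀ : ν₀ ∈ g.coeff.support)
    (hmax : ∀ ν ∈ g.coeff.support, ν ≠ ν₀ → ε * ν m < ε * ν₀ m) :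
    (laurentToQuotient m J).IsIntegralElem (Ideal.Quotient.mk J (monom (Pi.single m ε))) := by
  classical
  let a := g.coeff ν₀
  have ha : a ≠ 0 := Finsupp.mem_support_iff.1 hν₀
  -- The quotient `σ^{ν - ν₀}` splits as `σ^{β ν}`, free of `σ_m`, times `(σ_m^{-ε}) ^ k ν`.
  let β (ν : Fin n → ℤ) : Fin n → ℤ := Function.update (ν - ν₀) m 0
  let s := g.coeff.support.erase ν₀
  have hβ (ν) (hν : ν ∈ s) : monom (β ν) ∈ laurentSubring n m := by
    refine monom_mem_laurentSubring fun i hi => ?_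
    rcases (Fin.le_def.2 hi).eq_or_lt with rfl | hi
    · simp [β]
    · simp [β, hi.ne', hsupp ν (Finset.mem_of_mem_erase hν) i hi, hsupp ν₀ hν₀ i hi]
  let k (ν : Fin n → ℤ) : ℕ := (ε * ν₀ m - ε * ν m).toNat
  let r (ν : Fin n → ℤ) : laurentSubring n m :=
    if hν : ν ∈ s then ⟨(-a⁻¹ * g.coeff ν) • monom (β ν), Subalgebra.smul_mem _ (hβ ν hν) _⟩ else 0
  refine RingHom.isIntegralElem_of_sum_inv_pow_eq_one _ (v := Ideal.Quotient.mk J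
    (monom (Pi.single m (-ε)))) ?_ s r k (fun ν hν => ?_) ?_
  · rw [← map_mul, ← monom_add, ← Pi.single_add]
    simp [monom_zero]
  · have := hmax ν (Finset.mem_of_mem_erase hν) (Finset.ne_of_mem_erase hν)
    simp only [k]
    omega
  · have key : ∀ ν ∈ s, laurentToQuotient m J (r ν) *
        Ideal.Quotient.mk J (monom (Pi.single m (-ε))) ^ k ν =
        Ideal.Quotient.mk J ((-a⁻¹ • monom (-ν₀)) * (g.coeff ν • monom ν)) := by
      intro ν hν
      have hexp : β ν + k ν • Pi.single m (-ε) = -ν₀ + ν := by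
        have hk : (k ν : ℤ) = ε * ν₀ m - ε * ν m := by
          have := hmax ν (Finset.mem_of_mem_erase hν) (Finset.ne_of_mem_erase hν)
          exact Int.toNat_of_nonneg (by omega)
        ext i
        by_cases hi : i = m
        · subst hi
          simp [β, hk]
          linear_combination (ν i - ν₀ i) * hε
        · simp [β, hi]
          ring
      rw [← map_pow, ← monom_nsmul]
      change Ideal.Quotient.mk J (r ν : LaurentRing n) * _ = _
      rw [← map_mul]
      congr 1
      simp only [r, dif_pos hν]
      rw [smul_mul_assoc, ← monom_add, hexp, smul_mul_smul_comm, ← monom_add]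
    rw [Finset.sum_congr rfl key, ← map_sum, ← Finset.mul_sum, ← sub_eq_zero, ← map_one
      (Ideal.Quotient.mk J), ← map_sub, Ideal.Quotient.eq_zero_iff_mem]
    have hsum : ∑ ν ∈ s, g.coeff ν • monom ν = g - a • monom ν₀ := by
      rw [eq_sub_iff_add_eq, Finset.sum_erase_add _ _ hν₀, sum_smul_monom]
    have h1 : (-a⁻¹ • monom (-ν₀)) * (a • monom ν₀) = (-1 : LaurentRing n) := by
      rw [smul_mul_smul_comm, ← monom_add, neg_add_cancel, monom_zero, neg_mul,
        inv_mul_cancel₀ ha, neg_one_smul]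
    rw [hsum, mul_sub, h1, sub_neg_eq_add, add_sub_cancel_right]
    exact J.mul_mem_left _ hg

/-- The shear `ν ↦ ν + (w ⬝ ν) e_m` for a weight vector `w` with `w_m = 0`. -/
def shear {n : ℕ} (m : Fin n) (w : Fin n → ℤ) (hw : w m = 0) :
    Matrix.GeneralLinearGroup (Fin n) ℤ where
  val := 1 + Matrix.vecMulVec (Pi.single m 1) w
  inv := 1 - Matrix.vecMulVec (Pi.single m 1) w
  val_inv := by
    simp [add_mul, mul_sub, Matrix.vecMulVec_mul_vecMulVec, hw]
  inv_val := by
    simp [sub_mul, mul_add, Matrix.vecMulVec_mul_vecMulVec, hw]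

theorem shear_mulVec {n : ℕ} (m : Fin n) (w : Fin n → ℤ) (hw : w m = 0) (ν : Fin n → ℤ)
    (i : Fin n) :
    (shear m w hw).val.mulVec ν i = ν i + if i = m then w ⬝ᵥ ν else 0 := by
  simp [shear, Matrix.add_mulVec, Matrix.vecMulVec_mulVec, Pi.single_apply]

/-- With weights `t ^ (m - i)`, the new `m`-th entry of `ν` is the value at `t` of a polynomial
whose coefficients are the entries of `ν`. It suffices that `t` avoid the roots of finitely many
nonzero difference polynomials. -/
theorem exists_weight_injOn {n : ℕ} (m : Fin n) (F : Finset (Fin n → ℤ))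
    (hF : ∀ ν ∈ F, ∀ i, m < i → ν i = 0) :
    ∃ w : Fin n → ℤ, w m = 0 ∧ (∀ ν ∈ F, ∀ μ ∈ F, ν m + w ⬝ᵥ ν = μ m + w ⬝ᵥ μ → ν = μ) := by
  classical
  let P (v : Fin n → ℤ) : Polynomial ℤ :=
    ∑ i ∈ Finset.Iic m, Polynomial.C (v i) * Polynomial.X ^ (m - i : ℕ)
  have hP (v : Fin n → ℤ) (hv : ∀ i, m < i → v i = 0) (hP : P v = 0) : v = 0 := by
    ext j
    rcases lt_or_ge m j with hj | hj
    · exact hv j hj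
    · have := congrArg (fun p => p.coeff (m - j : ℕ)) hP
      simp only [P, Polynomial.finsetSum_coeff, Polynomial.coeff_C_mul_X_pow,
        Polynomial.coeff_zero] at this
      rw [Finset.sum_eq_single_of_mem j (Finset.mem_Iic.2 hj)] at this
      · simpa using this
      · intro i hi hij
        have := Finset.mem_Iic.1 hi
        rw [if_neg]
        rw [Fin.le_def] at hj this
        rw [Ne, Fin.ext_iff] at hij
        omega
  obtain ⟨t, ht⟩ : ∃ t : ℤ, (∏ x ∈ F.offDiag, P (x.1 - x.2)).eval t ≠ 0 := by
    by_contra! H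
    obtain ⟨x, hx, hx0⟩ := Finset.prod_eq_zero_iff.1 (Polynomial.funext (q := 0) (by simpa using H))
    obtain ⟨h1, h2, h3⟩ := Finset.mem_offDiag.1 hx
    refine h3 (sub_eq_zero.1 (hP _ (fun i hi => ?_) hx0))
    simp [hF _ h1 i hi, hF _ h2 i hi]
  refine ⟨fun i => if i < m then t ^ (m - i : ℕ) else 0, by simp, fun ν hν μ hμ h => ?_⟩
  by_contra hne
  refine ht ?_
  rw [Polynomial.eval_prod]
  refine Finset.prod_eq_zero (i := (ν, μ)) (Finset.mem_offDiag.2 ⟨hν, hμ, hne⟩) ?_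
  have hsum (v : Fin n → ℤ) : (P v).eval t =
      v m + (fun i => if i < m then t ^ (m - i : ℕ) else 0) ⬝ᵥ v := by
    simp only [P, Polynomial.eval_finsetSum, Polynomial.eval_mul, Polynomial.eval_C,
      Polynomial.eval_pow, Polynomial.eval_X, dotProduct, ite_mul, zero_mul]
    rw [← Finset.sum_filter, ← Finset.Iio_insert, Finset.sum_insert (by simp)]
    simp only [Nat.sub_self, pow_zero, mul_one, add_right_inj]
    exact Finset.sum_congr (by ext; simp) fun i _ => mul_comm _ _
  rw [hsum, dotProduct_sub, Pi.sub_apply]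
  linear_combination h

/-- The integral closure of `𝒜_m` in `𝒜/J` contains the image of every generator of `𝒜_{m+1}`;
transitivity finishes. -/
theorem isIntegral_laurentToQuotient_of_succ {n : ℕ} {J : Ideal (LaurentRing n)} (m : Fin n)
    (h : (laurentToQuotient (m + 1) J).IsIntegral)
    (h1 : (laurentToQuotient m J).IsIntegralElem (Ideal.Quotient.mk J (monom (Pi.single m 1))))
    (h2 : (laurentToQuotient m J).IsIntegralElem
      (Ideal.Quotient.mk J (monom (Pi.single m (-1))))) :
    (laurentToQuotient m J).IsIntegral := by
  let C := integralClosure (laurentSubring n m) (LaurentRing n ⧸ J)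
  have hC : laurentSubring n (m + 1) ≤ (C.restrictScalars ℝ).comap (Ideal.Quotient.mkₐ ℝ J) := by
    refine Algebra.adjoin_le ?_
    rintro f ⟨i, hi, hf⟩
    rcases (Nat.lt_succ_iff.1 hi).eq_or_lt with hi | hi
    · obtain rfl := Fin.ext hi
      rcases hf with rfl | rfl
      · exact h1
      · exact h2
    · exact isIntegral_algebraMap (R := laurentSubring n m) (A := LaurentRing n ⧸ J)
        (x := ⟨f, Algebra.subset_adjoin ⟨i, hi, hf⟩⟩)
  let g : laurentSubring n (m + 1) →+* C :=
    (laurentToQuotient (m + 1) J).codRestrict C fun x => hC x.2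
  have : Algebra.IsIntegral C (LaurentRing n ⧸ J) := ⟨fun x => by
    obtain ⟨p, hp, hpx⟩ := h x
    exact ⟨p.map g, hp.map g, by rw [Polynomial.eval₂_map]; exact hpx⟩⟩
  exact (Algebra.IsIntegral.trans (R := laurentSubring n m) C (B := LaurentRing n ⧸ J)).isIntegral

theorem isIntegral_laurentToQuotient_map_phi {n e : ℕ} {J : Ideal (LaurentRing n)}
    (T : Matrix.GeneralLinearGroup (Fin n) ℤ)
    (hT : ∀ f ∈ laurentSubring n e, phi T f ∈ laurentSubring n e)
    (h : (laurentToQuotient e J).IsIntegral) :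
    (laurentToQuotient e (J.map (phi T : LaurentRing n →+* LaurentRing n))).IsIntegral := by
  let ψ : laurentSubring n e →+* laurentSubring n e :=
    ((phi T : LaurentRing n →+* LaurentRing n).comp (laurentSubring n e).val.toRingHom).codRestrict
      _ fun f => hT f f.2
  let E := Ideal.quotientEquiv J (J.map (phi T : LaurentRing n →+* LaurentRing n))
    (phi T).toRingEquiv rfl
  -- The new structure map after `ψ` equals `E` after the old one.
  refine RingHom.IsIntegral.tower_top ψ _ ?_
  exact RingHom.IsIntegral.trans _ E.toRingHom h (RingHom.isIntegral_of_surjective _ E.surjective)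

theorem exists_isIntegral_laurentToQuotient_of_ne_zero {n : ℕ} {J : Ideal (LaurentRing n)}
    (m : Fin n) (h : (laurentToQuotient (m + 1) J).IsIntegral) {f : LaurentRing n} (hf : f ∈ J)
    (hfm : f ∈ laurentSubring n (m + 1)) (hf0 : f ≠ 0) :
    ∃ T : Matrix.GeneralLinearGroup (Fin n) ℤ,
      (laurentToQuotient m (J.map (phi T : LaurentRing n →+* LaurentRing n))).IsIntegral := by
  have hz {g : LaurentRing n} (hg : g ∈ laurentSubring n (m + 1)) :
      ∀ ν ∈ g.coeff.support, ∀ i, m < i → ν i = 0 :=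
    fun ν hν i hi => eq_zero_of_mem_support m.2 hg hν hi
  obtain ⟨w, hw, hinj⟩ := exists_weight_injOn m f.coeff.support (hz hfm)
  let T := shear m w hw
  -- The shear alters only the `m`-th exponent, so no later variable appears.
  have hT (g) (hg : g ∈ laurentSubring n (m + 1)) : phi T g ∈ laurentSubring n (m + 1) := by
    refine mem_laurentSubring_of_support fun ν hν i hi => ?_
    rw [phi, AddMonoidAlgebra.domCongr_support] at hν
    obtain ⟨μ, hμ, rfl⟩ := Finset.mem_map.1 hν
    have hi : m < i := hi
    exact (shear_mulVec m w hw μ i).trans (by simp [hz hg μ hμ i hi, hi.ne'])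
  have hinj' : Set.InjOn (fun ν : Fin n → ℤ => ν m) (phi T f).coeff.support := by
    intro ν hν μ hμ h
    rw [Finset.mem_coe, phi, AddMonoidAlgebra.domCongr_support] at hν hμ
    obtain ⟨ν, hν', rfl⟩ := Finset.mem_map.1 hν
    obtain ⟨μ, hμ', rfl⟩ := Finset.mem_map.1 hμ
    have := (shear_mulVec m w hw ν m).symm.trans (h.trans (shear_mulVec m w hw μ m))
    rw [if_pos rfl, if_pos rfl] at this
    rw [hinj ν hν' μ hμ' this]
  have hne : (phi T f).coeff.support.Nonempty := by
    simpa using hf0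
  have hint (ε : ℤ) (hε : ε * ε = 1) : (laurentToQuotient m
      (J.map (phi T : LaurentRing n →+* LaurentRing n))).IsIntegralElem
      (Ideal.Quotient.mk _ (monom (Pi.single m ε))) := by
    obtain ⟨ν₀, hν₀, hmax⟩ := Finset.exists_max_image _ (fun ν => ε * ν m) hne
    refine isIntegralElem_monom_of_unique_max (Ideal.mem_map_of_mem _ hf) m hε (hz (hT f hfm)) hν₀
      fun ν hν hne => (hmax ν hν).lt_of_ne fun h => hne (hinj' hν hν₀ ?_)
    exact mul_left_cancel₀ (left_ne_zero_of_mul_eq_one hε) h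
  exact ⟨T, isIntegral_laurentToQuotient_of_succ m
    (isIntegral_laurentToQuotient_map_phi T hT h) (hint 1 rfl) (hint (-1) rfl)⟩

theorem exists_isIntegral_laurentToQuotient {n : ℕ} (I : Ideal (LaurentRing n)) {e : ℕ}
    (he : e ≤ n) (hd : ringKrullDim (LaurentRing n ⧸ I) ≤ e) :
    ∃ T : Matrix.GeneralLinearGroup (Fin n) ℤ,
      (laurentToQuotient e (I.map (phi T : LaurentRing n →+* LaurentRing n))).IsIntegral := by
  induction he using Nat.decreasingInduction with
  | self => exact ⟨1, laurentToQuotient_self_isIntegral _⟩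
  | of_succ e he ih =>
    have hlt : ringKrullDim (LaurentRing n ⧸ I) < (e + 1 : ℕ) :=
      hd.trans_lt (by exact_mod_cast e.lt_succ_self)
    obtain ⟨S, hS⟩ := ih hlt.le
    obtain ⟨f, hfJ, hf, hf0⟩ := exists_ne_zero_mem_of_ringKrullDim_lt he hS
      ((ringKrullDim_quotient_map_phi S I).trans_lt hlt)
    obtain ⟨T, hT⟩ := exists_isIntegral_laurentToQuotient_of_ne_zero ⟨e, he⟩ hS hfJ hf hf0
    refine ⟨T * S, ?_⟩
    have : (phi (T * S) : LaurentRing n →+* LaurentRing n) =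
        (phi T : LaurentRing n →+* LaurentRing n).comp (phi S : LaurentRing n →+* LaurentRing n) :=
      RingHom.ext (phi_mul T S)
    rw [this, ← Ideal.map_map]
    exact hT

/-! ### Finite generation and the dimension bound -/

theorem ringKrullDim_le_of_finite {n q : ℕ}
    {R : Submodule (LaurentRing n) (Fin q → LaurentRing n)}
    (T : Matrix.GeneralLinearGroup (Fin n) ℤ) {e : ℕ} (he : e ≤ n)
    (h : Module.Finite (laurentSubring n e) (QuotientModule (phiHatImage T R))) :
    ringKrullDim (LaurentRing n ⧸ Module.annihilator (LaurentRing n) (QuotientModule R)) ≤ e := by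
  rw [← ringKrullDim_quotient_map_phi T, ← annihilator_phiHatImage]
  exact ringKrullDim_le_of_isIntegral he (isIntegral_laurentToQuotient_of_finite _)

theorem exists_forall_finite_of_ringKrullDim_le {n q : ℕ}
    (R : Submodule (LaurentRing n) (Fin q → LaurentRing n)) :
    ∃ T : Matrix.GeneralLinearGroup (Fin n) ℤ, ∀ e : ℕ,
      ringKrullDim (LaurentRing n ⧸ Module.annihilator (LaurentRing n) (QuotientModule R)) ≤ e →
      Module.Finite (laurentSubring n e) (QuotientModule (phiHatImage T R)) := by
  classical
  let I := Module.annihilator (LaurentRing n) (QuotientModule R)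
  have hn : ∃ e : ℕ, ringKrullDim (LaurentRing n ⧸ I) ≤ e :=
    ⟨n, ringKrullDim_le_of_isIntegral le_rfl (laurentToQuotient_self_isIntegral I)⟩
  -- The least natural number bounding the dimension is used; it is `0` when the quotient is the
  -- zero ring.
  obtain ⟨T, hT⟩ := exists_isIntegral_laurentToQuotient I (Nat.find_min' hn
    (ringKrullDim_le_of_isIntegral le_rfl (laurentToQuotient_self_isIntegral I))) (Nat.find_spec hn)
  refine ⟨T, fun e he => finite_of_isIntegral_laurentToQuotient _ ?_⟩
  rw [annihilator_phiHatImage]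
  exact laurentToQuotient_isIntegral_mono (Nat.find_min' hn he) hT

theorem IsStateSpace.finite {n q d γ : ℕ} {h : d ≤ n}
    {R : Submodule (LaurentRing n) (Fin q → LaurentRing n)}
    {𝒳 : Set (Fin γ → (Fin d → ℤ) → ℝ)} (hX : IsStateSpace h R 𝒳) :
    Module.Finite (laurentSubring n d) (QuotientModule R) := by
  obtain ⟨g, hg, -⟩ := hX
  exact ⟨_, (Set.finite_range g).coe_toFinset.symm ▸ hg⟩

theorem mainTheorem8 (n q : ℕ) (R : Submodule (LaurentRing n) (Fin q → LaurentRing n))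
    (d : WithBot ℕ∞)
    (hd : ringKrullDim
      (LaurentRing n ⧸ Module.annihilator (LaurentRing n) (QuotientModule R)) = d) :
    (∀ d' : ℕ, d' ≤ n →
      ((∃ T : Matrix.GeneralLinearGroup (Fin n) ℤ,
          Module.Finite (laurentSubring n d') (QuotientModule (phiHatImage T R))) ↔
        d ≤ (d' : WithBot ℕ∞))) ∧
    (∃ T : Matrix.GeneralLinearGroup (Fin n) ℤ, ∀ d' : ℕ, d' ≤ n →
      (Module.Finite (laurentSubring n d') (QuotientModule (phiHatImage T R)) ↔
        d ≤ (d' : WithBot ℕ∞))) ∧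
    (∀ (T : Matrix.GeneralLinearGroup (Fin n) ℤ) (d' : ℕ) (h : d' ≤ n) (γ : ℕ)
      (𝒳 : Set (Fin γ → (Fin d' → ℤ) → ℝ)),
      IsStateSpace h (phiHatImage T R) 𝒳 → d ≤ (d' : WithBot ℕ∞)) := by
  subst hd
  obtain ⟨T, hT⟩ := exists_forall_finite_of_ringKrullDim_le R
  refine ⟨fun d' h => ⟨fun ⟨T, hfin⟩ => ?_, fun hd => ⟨T, hT d' hd⟩⟩,
    ⟨T, fun d' h => ⟨fun hfin => ?_, hT d'⟩⟩, fun T d' h γ 𝒳 hX => ?_⟩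
  · exact ringKrullDim_le_of_finite T h hfin
  · exact ringKrullDim_le_of_finite T h hfin
  · exact ringKrullDim_le_of_finite T h hX.finite
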